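/- For a fixed real number $m>0$ let $\mathbb{N}_m$ denote the set of positive integers $n=2^s p_1\cdots p_r$ ($s,r\ge 0$, the $p_j$ odd primes, which may appear with multiplicity) such that $p_j\ge n^{1/m}$ for every $j$. (i) There is a sequence $\varepsilon_n\to 0$, depending only on $m$, such that for every $n\in\mathbb{N}_m$ there exists a real orthogonal $n\times n$ matrix $M$ with $$\frac{1-\varepsilon_n}{\sqrt n}\le |M_{i,j}|\le\frac{1+\varepsilon_n}{\sqrt n}\qquad\text{for all } i,j;$$ that is, all entries of $M$ have modulus $(1+o_m(1))\frac{1}{\sqrt n}$ as $n\to\infty$ in $\mathbb{N}_m$. (ii) There is a sequence $\varepsilon_n\to 0$, depending only on $m$, such that for every $n=2^s p_1\cdots p_r\in\mathbb{N}_m$ for which the odd primes $p_1,\dots,p_r$ are distinct and $s=0$ or $s=2$, there exists a circulant real orthogonal $n\times n$ matrix $M$ satisfying the same inequalities. -/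

import Mathlib

open Filter Topology

/-- `n = 2 ^ s * p₁ ⋯ p_r`, where `P` is the multiset of the odd primes `p₁, …, p_r`
(listed with multiplicity, possibly empty). -/
def IsTwoPowFactorization (n s : ℕ) (P : Multiset ℕ) : Prop :=
  (∀ p ∈ P, p.Prime ∧ Odd p) ∧ n = 2 ^ s * P.prod

/-- The set of positive integers `n = 2 ^ s * p₁ ⋯ p_r` all of whose odd prime factors `p_j`
are at least `n ^ (1 / m)`. -/
def largeOddPrimes (m : ℝ) : Set ℕ :=
  {n | ∃ (s : ℕ) (P : Multiset ℕ), IsTwoPowFactorization n s P ∧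
    ∀ p ∈ P, (n : ℝ) ^ (1 / m) ≤ (p : ℝ)}

/-- All entries of the `n × n` real matrix `M` have modulus between `(1 - ε) / √n` and
`(1 + ε) / √n`. -/
def IsFlatWithError {n : ℕ} (ε : ℝ) (M : Matrix (Fin n) (Fin n) ℝ) : Prop :=
  ∀ i j, (1 - ε) / √(n : ℝ) ≤ |M i j| ∧ |M i j| ≤ (1 + ε) / √(n : ℝ)

/-- `M` is circulant: `M i j` depends only on `i - j` modulo `n`. -/
def IsCirculant {n : ℕ} (M : Matrix (Fin n) (Fin n) ℝ) : Prop :=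
  ∃ v : Fin n → ℝ, M = Matrix.circulant v

/-! Flatness is multiplicative: Kronecker products preserve it for orthogonal matrices, and so do
products along the Chinese remainder theorem for circulant ones. Membership in `largeOddPrimes m`
bounds the number of odd primes by `⌊m⌋₊` and makes them all large, so it suffices to treat one
large prime `p` with relative error tending to 0. A circulant matrix is orthogonal when its symbol
is unimodular, and real when the symbol is Hermitian. So a unimodular Hermitian `a` on `ZMod p` is
wanted whose Fourier transform has modulus close to `√p` everywhere. The quadratic character `χ` is
nearly such a function, since Gauss sums give its transform; it fails only at frequency 0. If `χ(-1)
= -1`, an explicit correction suffices. If `χ(-1) = 1`, the values on residues are rotated slightly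
off the real axis, with random odd signs that keep the added imaginary part small in Fourier space.
-/

/-- Rademacher sums: some choice of signs makes finitely many sign sums simultaneously small. -/
theorem exists_signs_abs_sum_le {J K : Type*} [Fintype J] [Fintype K] (c : J → K → ℝ)
    (hc : ∀ j k, |c j k| ≤ 1) {l : ℝ} (hl : 0 < l) :
    ∃ σ : K → ℝ, (∀ k, σ k = 1 ∨ σ k = -1) ∧
      ∀ j, |∑ k, σ k * c j k| ≤
        Real.log (2 * Fintype.card J) / l + l * Fintype.card K / 2 := by
  classical
  let t : Finset ℝ := {1, -1}
  let Ω : Finset (K → ℝ) := Fintype.piFinset fun _ => t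
  -- The moment generating function factors over `k`, and each factor is controlled by `cosh x ≤ exp
  -- (x² / 2)`.
  have hmgf : ∀ (d : K → ℝ), (∀ k, |d k| ≤ 1) →
      ∑ σ ∈ Ω, Real.exp (l * ∑ k, σ k * d k) ≤
        (Ω.card : ℝ) * Real.exp (l ^ 2 * Fintype.card K / 2) := by
    intro d hd
    have h1 : ∑ σ ∈ Ω, Real.exp (l * ∑ k, σ k * d k) =
        ∏ k, ∑ x ∈ t, Real.exp (l * (x * d k)) := by
      rw [Finset.prod_univ_sum]
      refine Finset.sum_congr rfl fun σ _ => ?_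
      rw [← Real.exp_sum, Finset.mul_sum]
    have h2 : ∀ k, ∑ x ∈ t, Real.exp (l * (x * d k)) ≤ 2 * Real.exp (l ^ 2 / 2) := by
      intro k
      have h3 : ∑ x ∈ t, Real.exp (l * (x * d k)) = 2 * Real.cosh (l * d k) := by
        rw [Finset.sum_pair (by norm_num), Real.cosh_eq]
        ring_nf
      rw [h3]
      have h4 := Real.cosh_le_exp_half_sq (l * d k)
      have h5 : (l * d k) ^ 2 / 2 ≤ l ^ 2 / 2 := by
        have : (d k) ^ 2 ≤ 1 := (sq_le_one_iff_abs_le_one _).2 (hd k)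
        nlinarith [sq_nonneg l]
      have h6 := Real.exp_le_exp.2 h5
      linarith
    have hcard : (Ω.card : ℝ) = 2 ^ Fintype.card K := by
      have : t.card = 2 := Finset.card_pair (by norm_num)
      simp [Ω, this]
    rw [h1, hcard]
    calc ∏ k, ∑ x ∈ t, Real.exp (l * (x * d k)) ≤ ∏ _k : K, 2 * Real.exp (l ^ 2 / 2) :=
          Finset.prod_le_prod (fun k _ => Finset.sum_nonneg fun _ _ => (Real.exp_pos _).le)
            fun k _ => h2 k
      _ = _ := by
          rw [Finset.prod_const, mul_pow, ← Real.exp_nat_mul, Finset.card_univ]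
          ring_nf
  have hne : Ω.Nonempty := ⟨fun _ => 1, by simp [Ω, t]⟩
  -- Both signs of every sum enter one total, so a single `σ` at or below its average bounds all
  -- absolute values.
  have htot : ∑ σ ∈ Ω, ∑ j, (Real.exp (l * ∑ k, σ k * c j k) +
      Real.exp (l * ∑ k, σ k * (-c j k))) ≤
      ∑ _σ ∈ Ω, 2 * (Fintype.card J : ℝ) * Real.exp (l ^ 2 * Fintype.card K / 2) := by
    rw [Finset.sum_comm]
    simp_rw [Finset.sum_add_distrib]
    have h1 := Finset.sum_le_sum fun j (_ : j ∈ Finset.univ) => hmgf (c j) (hc j)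
    have h2 := Finset.sum_le_sum fun j (_ : j ∈ Finset.univ) =>
      hmgf (fun k => -c j k) (fun k => by simpa using hc j k)
    simp only [Finset.sum_const, Finset.card_univ, nsmul_eq_mul] at h1 h2 ⊢
    linarith
  obtain ⟨σ, hσ, hle⟩ := Finset.exists_le_of_sum_le hne htot
  refine ⟨σ, fun k => by simpa [t] using Fintype.mem_piFinset.1 hσ k, fun j => ?_⟩
  have hJ : (0 : ℝ) < 2 * Fintype.card J := by
    have : 0 < Fintype.card J := Fintype.card_pos_iff.2 ⟨j⟩
    positivity
  have hj : Real.exp (l * ∑ k, σ k * c j k) + Real.exp (l * ∑ k, σ k * (-c j k)) ≤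
      2 * (Fintype.card J : ℝ) * Real.exp (l ^ 2 * Fintype.card K / 2) :=
    (Finset.single_le_sum (f := fun j => Real.exp (l * ∑ k, σ k * c j k) +
      Real.exp (l * ∑ k, σ k * (-c j k)))
      (fun _ _ => add_nonneg (Real.exp_pos _).le (Real.exp_pos _).le) (Finset.mem_univ j)).trans hle
  have key : ∀ y : ℝ, Real.exp (l * y) ≤
      2 * (Fintype.card J : ℝ) * Real.exp (l ^ 2 * Fintype.card K / 2) →
      y ≤ Real.log (2 * Fintype.card J) / l + l * Fintype.card K / 2 := by
    intro y hy
    have h := Real.log_le_log (Real.exp_pos _) hy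
    rw [Real.log_exp, Real.log_mul hJ.ne' (Real.exp_pos _).ne', Real.log_exp] at h
    rw [← mul_le_mul_iff_right₀ hl]
    have : l * (Real.log (2 * Fintype.card J) / l + l * Fintype.card K / 2) =
      Real.log (2 * Fintype.card J) + l ^ 2 * Fintype.card K / 2 := by
      field_simp
    rw [this]; exact h
  rw [abs_le']
  refine ⟨key _ ?_, key _ ?_⟩
  · linarith [Real.exp_pos (l * ∑ k, σ k * (-c j k))]
  · simp only [mul_neg, Finset.sum_neg_distrib] at hj ⊢
    linarith [Real.exp_pos (l * ∑ k, σ k * c j k)]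

/-! ### Perfect sequences from Fourier transforms -/

/-- A real function on a finite abelian group orthogonal to all its nontrivial translates
and of unit norm. -/
def IsPerfectSequence {A : Type*} [AddCommGroup A] [Fintype A] [DecidableEq A] (v : A → ℝ) :
    Prop :=
  ∀ d, ∑ x, v x * v (x + d) = if d = 0 then 1 else 0

/-- There is a perfect sequence on `ZMod n` with moduli between `a / √n` and `b / √n`. -/
def HasFlatPerfectSequence (n : ℕ) (a b : ℝ) : Prop :=
  ∃ _ : NeZero n, ∃ v : ZMod n → ℝ, IsPerfectSequence v ∧
    ∀ x, a / √(n : ℝ) ≤ |v x| ∧ |v x| ≤ b / √(n : ℝ)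

theorem sum_stdAddChar_mul {n : ℕ} [NeZero n] (j : ZMod n) :
    ∑ k, (ZMod.stdAddChar (j * k) : ℂ) = if j = 0 then (n : ℂ) else 0 := by
  have h := AddChar.sum_mulShift (R' := ℂ) j (ZMod.isPrimitive_stdAddChar n)
  rw [ZMod.card] at h
  push_cast at h
  rw [← h]
  exact Finset.sum_congr rfl fun k _ => by rw [mul_comm]

theorem conj_stdAddChar {n : ℕ} [NeZero n] (j : ZMod n) :
    (starRingEnd ℂ) (ZMod.stdAddChar j) = ZMod.stdAddChar (-j) := by
  rw [AddChar.map_neg_eq_conj]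

/-- A unimodular Hermitian function whose Fourier transform has nearly constant modulus
yields a flat perfect sequence. -/
theorem hasFlatPerfectSequence_of_fourier {n : ℕ} [NeZero n] {η : ℝ} (a : ZMod n → ℂ)
    (ha : ∀ k, ‖a k‖ = 1) (hconj : ∀ k, a (-k) = (starRingEnd ℂ) (a k))
    (hflat : ∀ j, |‖∑ k, a k * ZMod.stdAddChar (j * k)‖ - √(n : ℝ)| ≤ η * √(n : ℝ)) :
    HasFlatPerfectSequence n (1 - η) (1 + η) := by
  refine ⟨inferInstance, ?_⟩
  have hn : (0 : ℝ) < n := Nat.cast_pos.2 (NeZero.pos n)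
  have hnC : (n : ℂ) ≠ 0 := Nat.cast_ne_zero.2 (NeZero.ne n)
  let w : ZMod n → ℂ := fun j => ∑ k, a k * ZMod.stdAddChar (j * k)
  have hw : ∀ j, (starRingEnd ℂ) (w j) = w j := by
    intro j
    simp only [w, map_sum, map_mul, conj_stdAddChar]
    rw [← Equiv.sum_comp (Equiv.neg (ZMod n))]
    refine Finset.sum_congr rfl fun k _ => ?_
    simp [hconj]
  have hre : ∀ j, ((w j).re : ℂ) = w j := fun j => Complex.conj_eq_iff_re.1 (hw j)
  have habs : ∀ j, |(w j).re| = ‖w j‖ := by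
    intro j
    rw [← Real.norm_eq_abs, ← Complex.norm_real, hre]
  refine ⟨fun j => (w j).re / n, ?_, ?_⟩
  · intro d
    -- Conjugating the real factor `w x` turns the autocorrelation into `n` times the transform of
    -- `|a|² = 1`.
    have h1 : ∑ x, w x * w (x + d) = if d = 0 then (n : ℂ) ^ 2 else 0 := by
      calc ∑ x, w x * w (x + d)
          = ∑ x, (∑ k, (starRingEnd ℂ) (a k) * ZMod.stdAddChar (-(x * k))) *
              ∑ l, a l * ZMod.stdAddChar ((x + d) * l) := by
            refine Finset.sum_congr rfl fun x _ => ?_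
            congr 1
            rw [← hw x]
            simp only [w, map_sum, map_mul, conj_stdAddChar]
        _ = ∑ k, ∑ l, (starRingEnd ℂ) (a k) * a l * ZMod.stdAddChar (d * l) *
              ∑ x, ZMod.stdAddChar ((l - k) * x) := by
            simp_rw [Finset.sum_mul_sum, Finset.mul_sum]
            rw [Finset.sum_comm]
            refine Finset.sum_congr rfl fun k _ => ?_
            rw [Finset.sum_comm]
            refine Finset.sum_congr rfl fun l _ => Finset.sum_congr rfl fun x _ => ?_
            have : (ZMod.stdAddChar (-(x * k)) : ℂ) * ZMod.stdAddChar ((x + d) * l) =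
                ZMod.stdAddChar (d * l) * ZMod.stdAddChar ((l - k) * x) := by
              rw [← AddChar.map_add_eq_mul, ← AddChar.map_add_eq_mul]
              congr 1; ring
            linear_combination (starRingEnd ℂ) (a k) * a l * this
        _ = ∑ k, ZMod.stdAddChar (d * k) * (n : ℂ) := by
            refine Finset.sum_congr rfl fun k _ => ?_
            simp_rw [sum_stdAddChar_mul, sub_eq_zero]
            simp only [mul_ite, mul_zero, Finset.sum_ite_eq', Finset.mem_univ, if_true]
            rw [← Complex.normSq_eq_conj_mul_self, Complex.normSq_eq_norm_sq, ha]
            simp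
        _ = _ := by
            rw [← Finset.sum_mul, sum_stdAddChar_mul]
            split_ifs <;> ring
    have h2 : ((∑ x, (w x).re / n * ((w (x + d)).re / n) : ℝ) : ℂ) =
        ((if d = 0 then 1 else 0 : ℝ) : ℂ) := by
      push_cast
      simp_rw [hre]
      have h3 : ∀ x, w x / (n : ℂ) * (w (x + d) / n) = (w x * w (x + d)) / (n : ℂ) ^ 2 := by
        intro x; field_simp
      simp_rw [h3]
      rw [← Finset.sum_div, h1]
      split_ifs
      · field_simp; simp
      · simp
    exact_mod_cast h2
  · intro j
    have h := abs_le.1 (hflat j)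
    have hs : 0 < √(n : ℝ) := Real.sqrt_pos.2 hn
    have hss : √(n : ℝ) * √(n : ℝ) = n := Real.mul_self_sqrt hn.le
    change (1 - η) / √(n : ℝ) ≤ |(w j).re / n| ∧ |(w j).re / n| ≤ (1 + η) / √(n : ℝ)
    rw [abs_div, habs, abs_of_pos hn]
    have e : ∀ x : ℝ, x / √(n : ℝ) = x * √(n : ℝ) / n := by
      intro x
      rw [div_eq_div_iff hs.ne' hn.ne', mul_assoc, hss]
    rw [e, e]
    refine ⟨div_le_div_of_nonneg_right ?_ hn.le, div_le_div_of_nonneg_right ?_ hn.le⟩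
    · change _ ≤ ‖∑ k, a k * ZMod.stdAddChar (j * k)‖
      linarith [h.1]
    · change ‖∑ k, a k * ZMod.stdAddChar (j * k)‖ ≤ _
      linarith [h.2]

/-! ### Random odd signs -/

/-- Square-root cancellation, up to a logarithm, for suitable odd signs on a symmetric set. -/
theorem exists_odd_signs_norm_sum_le {n : ℕ} [NeZero n] (hn : Odd n) (S : Finset (ZMod n))
    (hS : ∀ k ∈ S, -k ∈ S) (h0 : (0 : ZMod n) ∉ S) :
    ∃ η : ZMod n → ℝ, (∀ k, η k = 1 ∨ η k = -1) ∧ (∀ k ≠ 0, η (-k) = -η k) ∧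
      ∀ j, ‖∑ k ∈ S, (η k : ℂ) * Complex.I * ZMod.stdAddChar (j * k)‖ ≤
        2 * √(n : ℝ) * (Real.log (2 * n) + 1) := by
  classical
  have hnpos : (0 : ℝ) < n := Nat.cast_pos.2 (NeZero.pos n)
  have hs : 0 < √(n : ℝ) := Real.sqrt_pos.2 hnpos
  -- One representative per pair `±k`; as `i (z - conj z) = -2 Im z`, an odd sign on the pair
  -- contributes `2 σ k * c j k`.
  let c : ZMod n → ZMod n → ℝ := fun j k =>
    if k ∈ S ∧ k.val ≤ n / 2 then -(ZMod.stdAddChar (j * k) : ℂ).im else 0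
  -- The parameter `l = 1 / √n` makes the bound `√n log (2n) + √n / 2`.
  obtain ⟨σ, hσ, hb⟩ := exists_signs_abs_sum_le c (by
    intro j k
    simp only [c]
    split_ifs
    · rw [abs_neg]
      exact (Complex.abs_im_le_norm _).trans (by rw [AddChar.norm_apply])
    · simp) (inv_pos.2 hs)
  have hhalf : ∀ k : ZMod n, k ≠ 0 → ((-k).val ≤ n / 2 ↔ ¬ k.val ≤ n / 2) := by
    intro k hk
    rw [ZMod.neg_val, if_neg hk]
    have := ZMod.val_lt k
    obtain ⟨r, hr⟩ := hn
    omega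
  let η : ZMod n → ℝ := fun k => if k.val ≤ n / 2 then σ k else -σ (-k)
  refine ⟨η, ?_, ?_, ?_⟩
  · intro k
    simp only [η]
    split_ifs
    · exact hσ k
    · rcases hσ (-k) with h | h <;> simp [h]
  · intro k hk
    simp only [η, hhalf k hk, neg_neg]
    split_ifs <;> simp
  · intro j
    have key : ∑ k ∈ S, (η k : ℂ) * Complex.I * ZMod.stdAddChar (j * k) =
        ((2 * ∑ k, σ k * c j k : ℝ) : ℂ) := by
      have e1 : ∑ k ∈ S, (η k : ℂ) * Complex.I * ZMod.stdAddChar (j * k) =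
          ∑ k, (if k ∈ S ∧ k.val ≤ n / 2 then
            (σ k : ℂ) * Complex.I * ZMod.stdAddChar (j * k) else 0) +
          ∑ k, (if k ∈ S ∧ ¬ k.val ≤ n / 2 then
            -(σ (-k) : ℂ) * Complex.I * ZMod.stdAddChar (j * k) else 0) := by
        rw [← Finset.sum_add_distrib, ← Finset.sum_filter_add_sum_filter_not Finset.univ (· ∈ S)]
        simp only [Finset.filter_mem_eq_inter, Finset.univ_inter]
        rw [Finset.sum_eq_zero (s := Finset.filter (· ∉ S) Finset.univ), add_zero]
        · refine Finset.sum_congr rfl fun k hk => ?_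
          by_cases h : k.val ≤ n / 2 <;> simp [hk, h, η]
        · intro k hk
          simp [(Finset.mem_filter.1 hk).2]
      rw [e1, ← Equiv.sum_comp (Equiv.neg (ZMod n)) (fun k => if k ∈ S ∧ ¬ k.val ≤ n / 2 then
            -(σ (-k) : ℂ) * Complex.I * ZMod.stdAddChar (j * k) else 0),
        ← Finset.sum_add_distrib]
      push_cast
      rw [Finset.mul_sum]
      refine Finset.sum_congr rfl fun k _ => ?_
      have hmem : -k ∈ S ↔ k ∈ S := ⟨fun h => by simpa using hS _ h, hS k⟩
      simp only [Equiv.neg_apply, hmem, neg_neg, c]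
      by_cases hk : k ∈ S
      · have hk0 : k ≠ 0 := fun h => h0 (h ▸ hk)
        simp only [hk, hhalf k hk0, not_not, true_and]
        by_cases h : k.val ≤ n / 2
        · simp only [h, if_true]
          rw [mul_neg, ← conj_stdAddChar]
          generalize (ZMod.stdAddChar (j * k) : ℂ) = z
          apply Complex.ext <;> simp
          ring
        · simp [h]
      · simp [hk]
    rw [key, Complex.norm_real, Real.norm_eq_abs, abs_mul, abs_two]
    have h := hb j
    rw [ZMod.card, div_inv_eq_mul] at h
    have e2 : (√(n : ℝ))⁻¹ * n = √(n : ℝ) := by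
      rw [inv_mul_eq_iff_eq_mul₀ hs.ne', Real.mul_self_sqrt hnpos.le]
    rw [e2] at h
    nlinarith

/-! ### Sequences of prime length -/

section Prime

variable {p : ℕ} [Fact p.Prime]

theorem exists_gauss_sum (hp : p ≠ 2) :
    ∃ G : ℂ, G ^ 2 = (quadraticChar (ZMod p) (-1) : ℂ) * p ∧
      ∀ j, ∑ k, (quadraticChar (ZMod p) k : ℂ) * ZMod.stdAddChar (j * k) =
        (quadraticChar (ZMod p) j : ℂ) * G := by
  classical
  have hc : ringChar (ZMod p) ≠ 2 := by rwa [ZMod.ringChar_zmod_n]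
  let χ : MulChar (ZMod p) ℂ := (quadraticChar (ZMod p)).ringHomComp (Int.castRingHom ℂ)
  have hχ2 : χ.IsQuadratic := (quadraticChar_isQuadratic _).comp _
  have hχ1 : χ ≠ 1 := by
    intro h
    apply quadraticChar_ne_one hc
    refine MulChar.injective_ringHomComp (Int.castRingHom ℂ).injective_int ?_
    exact h.trans (MulChar.ringHomComp_one _).symm
  refine ⟨gaussSum χ ZMod.stdAddChar, ?_, ?_⟩
  · have := gaussSum_sq hχ1 hχ2 (ZMod.isPrimitive_stdAddChar p)
    rw [this, ZMod.card]
    rfl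
  · intro j
    by_cases hj : j = 0
    · subst hj
      have := quadraticChar_sum_zero hc
      simp only [zero_mul, AddChar.map_zero_eq_one, mul_one, quadraticChar_zero, Int.cast_zero]
      exact_mod_cast this
    · have h := gaussSum_mulShift χ ZMod.stdAddChar (Units.mk0 j hj)
      have h1 : χ j * χ j = 1 := by
        have := quadraticChar_sq_one hj
        change ((quadraticChar (ZMod p) j : ℤ) : ℂ) * ((quadraticChar (ZMod p) j : ℤ) : ℂ) = 1
        rw [← sq]
        exact_mod_cast this
      change _ = χ j * _
      rw [← h, ← mul_assoc, Units.val_mk0, h1, one_mul]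
      rfl

/-- The span of the delta at 0, the constants and `χ` is stable under the transform; the main terms
of both prime cases lie in it. -/
theorem sum_mul_stdAddChar_of_gauss {G : ℂ}
    (hG : ∀ j, ∑ k, (quadraticChar (ZMod p) k : ℂ) * ZMod.stdAddChar (j * k) =
        (quadraticChar (ZMod p) j : ℂ) * G) (α β γ : ℂ) (j : ZMod p) :
    ∑ k, ((if k = 0 then α else 0) + β + γ * (quadraticChar (ZMod p) k : ℂ)) *
      ZMod.stdAddChar (j * k) =
      α + β * (if j = 0 then (p : ℂ) else 0) + γ * (quadraticChar (ZMod p) j : ℂ) * G := by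
  simp_rw [add_mul, Finset.sum_add_distrib, ← sum_stdAddChar_mul, mul_assoc, ← Finset.mul_sum, hG]
  simp [ite_mul]

theorem quadraticChar_neg (k : ZMod p) :
    quadraticChar (ZMod p) (-k) = quadraticChar (ZMod p) (-1) * quadraticChar (ZMod p) k := by
  rw [← map_mul, neg_one_mul]

/-- Here `G² = -p`, so `G` is purely imaginary and `1 ± G` has modulus `√(p + 1) = s`. The symbol is
1 at 0 and `(1 - G χ) / s` elsewhere; its transform is `1 - 1/s ± p/s`. The two errors `|1 - 1/s|`
and `|p/s - √p|` are each at most 1. -/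
theorem hasFlatPerfectSequence_of_neg_one (hp : p ≠ 2)
    (h : quadraticChar (ZMod p) (-1) = -1) :
    HasFlatPerfectSequence p (1 - 2 / √(p : ℝ)) (1 + 2 / √(p : ℝ)) := by
  obtain ⟨G, hG2, hG⟩ := exists_gauss_sum hp
  have hp0 : (0 : ℝ) < p := Nat.cast_pos.2 (NeZero.pos p)
  have hr : 0 < √(p : ℝ) := Real.sqrt_pos.2 hp0
  have hrr : √(p : ℝ) * √(p : ℝ) = p := Real.mul_self_sqrt hp0.le
  obtain ⟨s, hs, hss⟩ : ∃ s : ℝ, 0 < s ∧ s * s = p + 1 :=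
    ⟨√(p + 1), Real.sqrt_pos.2 (by positivity), Real.mul_self_sqrt (by positivity)⟩
  have hsC : (s : ℂ) ≠ 0 := Complex.ofReal_ne_zero.2 hs.ne'
  rw [h] at hG2
  have hre2 : G.re * G.re - G.im * G.im = -p := by
    have := congrArg Complex.re hG2
    simpa [sq] using this
  have him2 : G.re * G.im = 0 := by
    have := congrArg Complex.im hG2
    simp [sq] at this
    linarith
  have hGre : G.re = 0 := by
    rcases mul_eq_zero.1 him2 with h | h
    · exact h
    · rw [h] at hre2; nlinarith [mul_self_nonneg G.re]
  have hGim : G.im * G.im = p := by rw [hGre] at hre2; linarith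
  have hGconj : (starRingEnd ℂ) G = -G := by
    apply Complex.ext <;> simp [hGre]
  have hs1 : 1 ≤ s := by nlinarith
  have hsr : √(p : ℝ) ≤ s := by nlinarith
  have hsr' : s ≤ √(p : ℝ) + 1 := by nlinarith
  have hps : |p / s - √(p : ℝ)| ≤ 1 := by
    rw [abs_le]
    constructor
    · rw [neg_le_sub_iff_le_add, ← sub_le_iff_le_add, le_div_iff₀ hs]
      nlinarith
    · have : (p : ℝ) / s ≤ √(p : ℝ) := by rw [div_le_iff₀ hs]; nlinarith
      linarith
  have hinv : |1 - 1 / s| ≤ 1 := by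
    have h1 : 1 / s ≤ 1 := (div_le_one hs).2 hs1
    have h2 : 0 < 1 / s := by positivity
    rw [abs_le]; constructor <;> linarith
  let a : ZMod p → ℂ := fun k => (if k = 0 then (1 - 1 / s : ℂ) else 0) + 1 / s +
    (-G / s) * (quadraticChar (ZMod p) k : ℂ)
  refine hasFlatPerfectSequence_of_fourier a ?_ ?_ ?_
  · intro k
    by_cases hk : k = 0
    · simp [a, hk]
    · have e : a k = (1 - G * (quadraticChar (ZMod p) k : ℂ)) / s := by
        simp only [a, hk, if_false]; ring
      rw [e, norm_div, Complex.norm_real, Real.norm_eq_abs, abs_of_pos hs, div_eq_one_iff_eq hs.ne',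
        ← sq_eq_sq₀ (norm_nonneg _) hs.le, ← Complex.normSq_eq_norm_sq, sq, hss]
      rcases quadraticChar_dichotomy hk with h | h <;>
        simp [h, Complex.normSq_apply, hGre, hGim] <;> ring
  · intro k
    simp only [a, neg_eq_zero, quadraticChar_neg, h]
    split_ifs <;> simp [hGconj] <;> ring
  · intro j
    rw [sum_mul_stdAddChar_of_gauss hG, div_mul_cancel₀ _ hr.ne']
    have e : ∃ ε : ℝ, (ε = 1 ∨ ε = -1) ∧
        (1 - 1 / s : ℂ) + 1 / s * (if j = 0 then (p : ℂ) else 0) +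
          (-G / s) * (quadraticChar (ZMod p) j : ℂ) * G =
        ((1 - 1 / s + ε * (p / s) : ℝ) : ℂ) := by
      by_cases hj : j = 0
      · refine ⟨1, Or.inl rfl, ?_⟩
        simp [hj]; ring
      · refine ⟨(quadraticChar (ZMod p) j : ℝ), ?_, ?_⟩
        · rcases quadraticChar_dichotomy hj with h | h <;> simp [h]
        · have : G * G = -(p : ℂ) := by rw [← sq, hG2]; simp
          simp only [hj, if_false]
          push_cast
          linear_combination (-(quadraticChar (ZMod p) j : ℂ) / s) * this
    obtain ⟨ε, hε, e⟩ := e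
    rw [e, Complex.norm_real, Real.norm_eq_abs]
    have h1 : abs (|1 - 1 / s + ε * (p / s)| - |ε * (p / s)|) ≤ 1 := by
      refine (abs_abs_sub_abs_le_abs_sub _ _).trans ?_
      simpa using hinv
    have h2 : |ε * (p / s)| = p / s := by
      rw [abs_mul, abs_of_pos (div_pos hp0 hs)]
      rcases hε with h | h <;> simp [h]
    rw [h2] at h1
    rw [abs_le] at *
    constructor <;> linarith [h1.1, h1.2, hps.1, hps.2]

end Prime

theorem HasFlatPerfectSequence.mono {n : ℕ} {a b a' b' : ℝ} (h : HasFlatPerfectSequence n a b)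
    (ha : a' ≤ a) (hb : b ≤ b') : HasFlatPerfectSequence n a' b' := by
  obtain ⟨hn, v, hv, hf⟩ := h
  refine ⟨hn, v, hv, fun x => ⟨le_trans ?_ (hf x).1, (hf x).2.trans ?_⟩⟩ <;> gcongr

/-- Here `G` is real. The symbol is 1 at 0, `-1` on nonresidues and `c ± i t` on residues, with `c²
+ t² = 1`. Odd signs make it Hermitian. Since `t` has order `p^(-1/4)`, the random part has relative
size `p^(-1/4) log p`. -/
theorem hasFlatPerfectSequence_of_one {p : ℕ} [Fact p.Prime] (hp : p ≠ 2)
    (h : quadraticChar (ZMod p) (-1) = 1) :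
    HasFlatPerfectSequence p (1 - (3 / √(p : ℝ) + 4 / √√(p : ℝ) * (Real.log (2 * p) + 1)))
      (1 + (3 / √(p : ℝ) + 4 / √√(p : ℝ) * (Real.log (2 * p) + 1))) := by
  classical
  obtain ⟨G, hG2, hG⟩ := exists_gauss_sum hp
  have hp0 : (0 : ℝ) < p := Nat.cast_pos.2 (NeZero.pos p)
  have hodd : Odd p := (Fact.out : p.Prime).odd_of_ne_two hp
  let S : Finset (ZMod p) := Finset.univ.filter fun k => quadraticChar (ZMod p) k = 1
  obtain ⟨η, hη1, hηneg, hηb⟩ := exists_odd_signs_norm_sum_le hodd S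
    (by intro k; simp only [S, Finset.mem_filter, Finset.mem_univ, true_and, quadraticChar_neg, h,
          one_mul, imp_self])
    (by simp [S])
  obtain ⟨r, hr⟩ : ∃ r, r = √(p : ℝ) := ⟨_, rfl⟩
  have hr0 : 0 < r := hr ▸ Real.sqrt_pos.2 hp0
  have hrr : r * r = p := hr ▸ Real.mul_self_sqrt hp0.le
  obtain ⟨u, hu⟩ : ∃ u, u = √r := ⟨_, rfl⟩
  have hu0 : 0 < u := hu ▸ Real.sqrt_pos.2 hr0
  have huu : u * u = r := hu ▸ Real.mul_self_sqrt hr0.le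
  have hp1 : (1 : ℝ) ≤ p := by exact_mod_cast (Fact.out : p.Prime).one_lt.le
  have hr1 : 1 ≤ r := by nlinarith
  rw [← hr] at hηb ⊢
  rw [← hu]
  obtain ⟨B, hB⟩ : ∃ B, B = Real.log (2 * p) + 1 := ⟨_, rfl⟩
  rw [← hB] at hηb ⊢
  have hB0 : 0 ≤ B := by
    have : 0 ≤ Real.log (2 * p) := Real.log_nonneg (by linarith)
    linarith
  rw [h] at hG2
  have hGn : ‖G‖ = r := by
    rw [← sq_eq_sq₀ (norm_nonneg _) hr0.le, ← norm_pow, hG2]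
    simp [sq, hrr]
  have hGconj : (starRingEnd ℂ) G = G := by
    have him : G.re * G.im = 0 := by
      have := congrArg Complex.im hG2
      simp [sq] at this
      linarith
    have hre : G.re * G.re - G.im * G.im = p := by
      have := congrArg Complex.re hG2
      simpa [sq] using this
    have : G.im = 0 := by
      rcases mul_eq_zero.1 him with h | h
      · rw [h] at hre; nlinarith [mul_self_nonneg G.im]
      · exact h
    exact Complex.conj_eq_iff_im.2 this
  -- Chosen so that the constant component `(c - 1) / 2` has transform exactly `-√p` at frequency 0.
  obtain ⟨c, hc⟩ : ∃ c, c = 1 - 2 / r := ⟨_, rfl⟩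
  have hcr : (1 - c) * r = 2 := by rw [hc]; field_simp; ring
  have hc1 : c ≤ 1 := by nlinarith
  have hc2 : -1 ≤ c := by nlinarith
  obtain ⟨t, ht0, htt⟩ : ∃ t : ℝ, 0 ≤ t ∧ t * t = 1 - c * c :=
    ⟨√(1 - c * c), Real.sqrt_nonneg _, Real.mul_self_sqrt (by nlinarith)⟩
  have htu : t * u ≤ 2 := by
    have : (t * u) * (t * u) ≤ 2 * 2 := by
      have e : (t * u) * (t * u) = (1 + c) * 2 := by
        rw [← hcr]; linear_combination (u * u) * htt + (1 - c * c) * huu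
      rw [e]; linarith
    exact abs_le_of_sq_le_sq' (by nlinarith) (by norm_num) |>.2
  let a : ZMod p → ℂ := fun k => ((if k = 0 then ((3 - c) / 2 : ℂ) else 0) + (c - 1) / 2 +
    (c + 1) / 2 * (quadraticChar (ZMod p) k : ℂ)) +
      t * (if k ∈ S then (η k : ℂ) * Complex.I else 0)
  have ha0 : a 0 = 1 := by
    simp [a, S]; ring
  have haS : ∀ k, k ≠ 0 → quadraticChar (ZMod p) k = 1 → a k = c + t * η k * Complex.I := by
    intro k hk hq
    simp only [a, S, Finset.mem_filter, Finset.mem_univ, true_and, hk, hq]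
    norm_num
    try ring
  have haN : ∀ k, k ≠ 0 → quadraticChar (ZMod p) k = -1 → a k = -1 := by
    intro k hk hq
    simp only [a, S, Finset.mem_filter, Finset.mem_univ, true_and, hk, hq]
    norm_num
    try ring
  refine hasFlatPerfectSequence_of_fourier a ?_ ?_ ?_
  · intro k
    by_cases hk : k = 0
    · simp [hk, ha0]
    rcases quadraticChar_dichotomy hk with hq | hq
    · rw [haS k hk hq, ← sq_eq_sq₀ (norm_nonneg _) zero_le_one, ← Complex.normSq_eq_norm_sq]
      have : η k * η k = 1 := by rcases hη1 k with h | h <;> simp [h]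
      simp [Complex.normSq_apply]
      linear_combination htt + t * t * this
    · simp [haN k hk hq]
  · intro k
    by_cases hk : k = 0
    · simp [hk, ha0]
    have hnk : quadraticChar (ZMod p) (-k) = quadraticChar (ZMod p) k := by
      rw [quadraticChar_neg, h, one_mul]
    rcases quadraticChar_dichotomy hk with hq | hq
    · rw [haS k hk hq, haS _ (neg_ne_zero.2 hk) (hnk.trans hq), hηneg k hk]
      simp
    · rw [haN k hk hq, haN _ (neg_ne_zero.2 hk) (hnk.trans hq)]
      simp
  · intro j
    obtain ⟨E, hE, hEb⟩ : ∃ E, E = ∑ k ∈ S, (η k : ℂ) * Complex.I * ZMod.stdAddChar (j * k) ∧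
      ‖E‖ ≤ 2 * r * B := ⟨_, rfl, hηb j⟩
    have hsum : ∑ k, a k * ZMod.stdAddChar (j * k) =
        ((3 - c) / 2 + (c - 1) / 2 * (if j = 0 then (p : ℂ) else 0) +
          (c + 1) / 2 * (quadraticChar (ZMod p) j : ℂ) * G) + t * E := by
      simp only [a]
      simp_rw [add_mul _ ((t : ℂ) * _)]
      rw [Finset.sum_add_distrib, sum_mul_stdAddChar_of_gauss hG, hE, Finset.mul_sum]
      congr 1
      simp only [mul_ite, ite_mul, mul_zero, zero_mul]
      rw [← Finset.sum_filter]
      simp only [Finset.filter_mem_eq_inter, Finset.univ_inter]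
      exact Finset.sum_congr rfl fun k _ => by ring
    -- Main term: its modulus is `r` at `j = 0` and `(c + 1) / 2 * r = r - 1` elsewhere.
    obtain ⟨D, hD, hDb⟩ : ∃ D : ℂ, D = (c - 1) / 2 * (if j = 0 then (p : ℂ) else 0) +
          (c + 1) / 2 * (quadraticChar (ZMod p) j : ℂ) * G ∧ |‖D‖ - r| ≤ 1 := by
      refine ⟨_, rfl, ?_⟩
      by_cases hj : j = 0
      · have e : (c - 1) / 2 * (if j = 0 then (p : ℂ) else 0) +
          (c + 1) / 2 * (quadraticChar (ZMod p) j : ℂ) * G = ((-r : ℝ) : ℂ) := by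
          have : (c - 1) / 2 * (p : ℝ) = -r := by
            rw [← hrr]; linear_combination (-r / 2) * hcr
          rw [← this]
          simp [hj]
        rw [e, Complex.norm_real, Real.norm_eq_abs, abs_neg, abs_of_pos hr0]
        simp
      · have e : ‖(c - 1) / 2 * (if j = 0 then (p : ℂ) else 0) +
          (c + 1) / 2 * (quadraticChar (ZMod p) j : ℂ) * G‖ = (c + 1) / 2 * r := by
          have e1 : ‖((quadraticChar (ZMod p) j : ℤ) : ℂ)‖ = 1 := by
            rcases quadraticChar_dichotomy hj with h | h <;> simp [h]
          have e2 : ‖((c : ℂ) + 1) / 2‖ = (c + 1) / 2 := by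
            have : ((c : ℂ) + 1) / 2 = (((c + 1) / 2 : ℝ) : ℂ) := by push_cast; ring
            rw [this, Complex.norm_real, Real.norm_eq_abs, abs_of_nonneg (by linarith)]
          simp only [hj, if_false, mul_zero, zero_add]
          rw [norm_mul, norm_mul, e1, e2, hGn, mul_one]
        rw [e, abs_le]
        constructor <;> nlinarith
    have hdiff : ‖∑ k, a k * ZMod.stdAddChar (j * k) - D‖ ≤ 2 + t * (2 * r * B) := by
      have e : ∑ k, a k * ZMod.stdAddChar (j * k) - D = (3 - c) / 2 + t * E := by
        rw [hsum, hD]; ring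
      rw [e]
      refine (norm_add_le _ _).trans (add_le_add ?_ ?_)
      · have : ((3 : ℂ) - c) / 2 = (((3 - c) / 2 : ℝ) : ℂ) := by push_cast; ring
        rw [this, Complex.norm_real, Real.norm_eq_abs, abs_of_nonneg (by linarith)]
        linarith
      · rw [norm_mul, Complex.norm_real, Real.norm_eq_abs, abs_of_nonneg ht0]
        exact mul_le_mul_of_nonneg_left hEb ht0
    have h1 := (abs_norm_sub_norm_le (∑ k, a k * ZMod.stdAddChar (j * k)) D).trans hdiff
    -- The 3 collects 1 from `D` and at most 2 from the delta coefficient `(3 - c) / 2`.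
    have hfin : 3 + t * (2 * r * B) ≤ (3 / r + 4 / u * B) * r := by
      have e : (3 / r + 4 / u * B) * r = 3 + (2 / u) * (2 * r * B) := by field_simp; ring
      rw [e]
      have : t ≤ 2 / u := by rw [le_div_iff₀ hu0]; exact htu
      have h2 : 0 ≤ 2 * r * B := by positivity
      nlinarith
    rw [← hr]
    rw [abs_le] at *
    constructor <;> linarith [h1.1, h1.2, hDb.1, hDb.2]

theorem eventually_hasFlatPerfectSequence_of_prime {η : ℝ} (hη : 0 < η) :
    ∀ᶠ p : ℕ in atTop, p.Prime → Odd p → HasFlatPerfectSequence p (1 - η) (1 + η) := by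
  have hlim : Tendsto (fun x : ℝ => 3 / √x + 4 / √√x * (Real.log (2 * x) + 1)) atTop (𝓝 0) := by
    have hs : Tendsto (fun x : ℝ => √x) atTop atTop := Real.tendsto_sqrt_atTop
    have hss : Tendsto (fun x : ℝ => √√x) atTop atTop := hs.comp hs
    have h1 : Tendsto (fun x : ℝ => 3 / √x) atTop (𝓝 0) := hs.const_div_atTop 3
    have h2 : Tendsto (fun x : ℝ => 4 * (Real.log 2 + 1) / √√x) atTop (𝓝 0) :=
      hss.const_div_atTop _
    have h3 : Tendsto (fun y : ℝ => Real.log y / y) atTop (𝓝 0) :=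
      Real.isLittleO_log_id_atTop.tendsto_div_nhds_zero
    have h4 := ((h3.comp hss).const_mul 16).add (h1.add h2)
    rw [mul_zero, add_zero, add_zero] at h4
    refine h4.congr' ?_
    filter_upwards [eventually_gt_atTop 0] with x hx
    have e : Real.log √√x = Real.log x / 4 := by
      rw [Real.log_sqrt (Real.sqrt_nonneg _), Real.log_sqrt hx.le]; ring
    simp only [Function.comp_apply, e, Real.log_mul two_ne_zero hx.ne']
    ring
  have h := (hlim.comp tendsto_natCast_atTop_atTop).eventually (gt_mem_nhds hη)
  filter_upwards [h] with p hp hprime hodd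
  have : Fact p.Prime := ⟨hprime⟩
  have hp2 : p ≠ 2 := by rintro rfl; exact absurd hodd (by decide)
  simp only [Function.comp_apply] at hp
  rcases quadraticChar_dichotomy (F := ZMod p) (a := -1) (by simp) with h | h
  · exact (hasFlatPerfectSequence_of_one hp2 h).mono (by linarith) (by linarith)
  · have hp1 : (1 : ℝ) ≤ p := by exact_mod_cast hprime.one_lt.le
    have h2 : 2 / √(p : ℝ) ≤ 3 / √(p : ℝ) := by gcongr; norm_num
    have h3 : 0 ≤ 4 / √√(p : ℝ) * (Real.log (2 * p) + 1) :=
      mul_nonneg (by positivity) (by linarith [Real.log_nonneg (x := 2 * (p : ℝ)) (by linarith)])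
    exact (hasFlatPerfectSequence_of_neg_one hp2 h).mono (by linarith) (by linarith)

/-! ### Products of perfect sequences and of orthogonal matrices -/

theorem hasFlatPerfectSequence_one : HasFlatPerfectSequence 1 1 1 :=
  ⟨inferInstance, fun _ => 1, fun d => by simp [Subsingleton.elim d 0], fun _ => by simp⟩

/-- The sequence `(-1, 1, 1, 1) / 2` of the circulant Hadamard matrix of order 4 supplies the case
`s = 2`. -/
theorem hasFlatPerfectSequence_four : HasFlatPerfectSequence 4 1 1 := by
  have h4 : √((4 : ℕ) : ℝ) = 2 := by
    rw [show ((4 : ℕ) : ℝ) = 2 ^ 2 by norm_num, Real.sqrt_sq (by norm_num)]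
  refine ⟨inferInstance, fun x => if x = 0 then -(1 / 2) else 1 / 2, fun d => ?_, fun x => ?_⟩
  · have hsum : ∀ f : ZMod 4 → ℝ, ∑ x, f x = f 0 + f 1 + f 2 + f 3 := Fin.sum_univ_four
    have hd : d = 0 ∨ d = 1 ∨ d = 2 ∨ d = 3 := by revert d; decide
    have e1 : (1 : ZMod 4) ≠ 0 := by decide
    have e2 : (2 : ZMod 4) ≠ 0 := by decide
    have e3 : (3 : ZMod 4) ≠ 0 := by decide
    have e11 : (1 + 1 : ZMod 4) ≠ 0 := by decide
    have e13 : (1 + 3 : ZMod 4) = 0 := by decide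
    have e12 : (1 + 2 : ZMod 4) ≠ 0 := by decide
    have e21 : (2 + 1 : ZMod 4) ≠ 0 := by decide
    have e22 : (2 + 2 : ZMod 4) = 0 := by decide
    have e23 : (2 + 3 : ZMod 4) ≠ 0 := by decide
    have e31 : (3 + 1 : ZMod 4) = 0 := by decide
    have e32 : (3 + 2 : ZMod 4) ≠ 0 := by decide
    have e33 : (3 + 3 : ZMod 4) ≠ 0 := by decide
    rw [hsum]
    rcases hd with rfl | rfl | rfl | rfl <;>
      simp only [add_zero, zero_add, if_true, if_false, *] <;> norm_num
  · rw [h4]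
    dsimp only
    split_ifs <;> norm_num [abs_of_pos]

/-- Autocorrelations factor over `ZMod m × ZMod n`, which the Chinese remainder theorem identifies
with `ZMod (m * n)`. -/
theorem HasFlatPerfectSequence.mul {m n : ℕ} {a b a' b' : ℝ} (hmn : m.Coprime n)
    (ha' : 0 ≤ a') (h : HasFlatPerfectSequence m a b)
    (h' : HasFlatPerfectSequence n a' b') :
    HasFlatPerfectSequence (m * n) (a * a') (b * b') := by
  obtain ⟨hm, v, hv, hvf⟩ := h
  obtain ⟨hn, w, hw, hwf⟩ := h'
  have hne : NeZero (m * n) := ⟨mul_ne_zero hm.out hn.out⟩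
  let f := ZMod.chineseRemainder hmn
  refine ⟨hne, fun x => v (f x).1 * w (f x).2, fun d => ?_, fun x => ?_⟩
  · have e : ∑ x, v (f x).1 * w (f x).2 * (v (f (x + d)).1 * w (f (x + d)).2) =
        ∑ y : ZMod m × ZMod n, v y.1 * w y.2 * (v (y.1 + (f d).1) * w (y.2 + (f d).2)) := by
      rw [← Equiv.sum_comp f.toEquiv]
      refine Finset.sum_congr rfl fun x _ => ?_
      simp [map_add]
    rw [e, Fintype.sum_prod_type]
    have e2 : ∀ x y, v x * w y * (v (x + (f d).1) * w (y + (f d).2)) =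
        (v x * v (x + (f d).1)) * (w y * w (y + (f d).2)) := fun x y => by ring
    simp_rw [e2, ← Finset.mul_sum, ← Finset.sum_mul]
    rw [hv, hw]
    have hd : d = 0 ↔ (f d).1 = 0 ∧ (f d).2 = 0 := by
      rw [← map_eq_zero_iff f f.injective, Prod.ext_iff]; rfl
    by_cases h1 : (f d).1 = 0 <;> by_cases h2 : (f d).2 = 0 <;> simp [hd, h1, h2]
  · have h1 := hvf (f x).1
    have h2 := hwf (f x).2
    rw [abs_mul, Nat.cast_mul, Real.sqrt_mul (Nat.cast_nonneg _), mul_div_mul_comm,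
      mul_div_mul_comm]
    exact ⟨mul_le_mul h1.1 h2.1 (by positivity) (abs_nonneg _),
      mul_le_mul h1.2 h2.2 (abs_nonneg _) ((abs_nonneg _).trans h1.2)⟩

/-- There is an `n × n` orthogonal matrix with moduli of entries between `a / √n` and `b / √n`. -/
def HasFlatOrthogonal (n : ℕ) (a b : ℝ) : Prop :=
  ∃ M ∈ Matrix.orthogonalGroup (Fin n) ℝ, ∀ i j, a / √(n : ℝ) ≤ |M i j| ∧ |M i j| ≤ b / √(n : ℝ)

theorem HasFlatPerfectSequence.exists_circulant {n : ℕ} {a b : ℝ}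
    (h : HasFlatPerfectSequence n a b) :
    ∃ M ∈ Matrix.orthogonalGroup (Fin n) ℝ, IsCirculant M ∧
      ∀ i j, a / √(n : ℝ) ≤ |M i j| ∧ |M i j| ≤ b / √(n : ℝ) := by
  obtain ⟨hn, v, hv, hf⟩ := h
  -- For `n = k + 1` the type `ZMod n` is definitionally `Fin n`.
  obtain ⟨k, rfl⟩ := Nat.exists_eq_succ_of_ne_zero hn.out
  let w : Fin (k + 1) → ℝ := v
  refine ⟨Matrix.circulant w, ?_, ⟨w, rfl⟩, fun i j => hf (i - j)⟩
  rw [Matrix.mem_orthogonalGroup_iff]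
  ext i j
  have key : ∀ i j : ZMod (k + 1), ∑ x, v (i - x) * v (j - x) = if i = j then 1 else 0 := by
    intro i j
    rw [← Equiv.sum_comp (Equiv.subLeft i)]
    have hd := hv (j - i)
    simp only [sub_eq_zero, eq_comm (a := j)] at hd
    rw [← hd]
    refine Finset.sum_congr rfl fun x _ => ?_
    rw [Equiv.subLeft_apply, sub_sub_cancel, sub_sub_eq_add_sub, add_sub_right_comm, add_comm x]
  have e := key i j
  rw [Matrix.mul_apply, Matrix.one_apply]
  exact e

theorem HasFlatPerfectSequence.hasFlatOrthogonal {n : ℕ} {a b : ℝ}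
    (h : HasFlatPerfectSequence n a b) : HasFlatOrthogonal n a b := by
  obtain ⟨M, hM, -, hf⟩ := h.exists_circulant
  exact ⟨M, hM, hf⟩

theorem hasFlatOrthogonal_two : HasFlatOrthogonal 2 1 1 := by
  have h2 : √(2 : ℝ) * √(2 : ℝ) = 2 := Real.mul_self_sqrt (by norm_num)
  have hs : (√(2 : ℝ))⁻¹ * (√(2 : ℝ))⁻¹ = 1 / 2 := by rw [← mul_inv, h2]; norm_num
  refine ⟨!![1 / √2, 1 / √2; 1 / √2, -(1 / √2)], ?_, ?_⟩
  · rw [Matrix.mem_orthogonalGroup_iff]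
    ext i j
    fin_cases i <;> fin_cases j <;>
      simp [Matrix.mul_apply, Fin.sum_univ_two, hs] <;> norm_num
  · intro i j
    fin_cases i <;> fin_cases j <;> simp [abs_of_nonneg]

/-- Kronecker products need no coprimality, so repeated primes and all powers of 2 are allowed. -/
theorem HasFlatOrthogonal.mul {m n : ℕ} {a b a' b' : ℝ}
    (ha' : 0 ≤ a') (h : HasFlatOrthogonal m a b) (h' : HasFlatOrthogonal n a' b') :
    HasFlatOrthogonal (m * n) (a * a') (b * b') := by
  obtain ⟨M, hM, hMf⟩ := h
  obtain ⟨N, hN, hNf⟩ := h'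
  refine ⟨(Matrix.kroneckerMap (· * ·) M N).submatrix finProdFinEquiv.symm finProdFinEquiv.symm, ?_, ?_⟩
  · have h := Matrix.kronecker_mem_unitary hM hN
    rw [Matrix.mem_orthogonalGroup_iff]
    have h2 := Unitary.mul_star_self_of_mem h
    rw [Matrix.star_eq_conjTranspose, Matrix.conjTranspose_eq_transpose_of_trivial] at h2
    rw [Matrix.transpose_submatrix, Matrix.submatrix_mul_equiv]
    exact (congrArg (fun A => Matrix.submatrix A _ _) h2).trans (Matrix.submatrix_one_equiv _)
  · intro i j
    have h1 := hMf (finProdFinEquiv.symm i).1 (finProdFinEquiv.symm j).1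
    have h2 := hNf (finProdFinEquiv.symm i).2 (finProdFinEquiv.symm j).2
    rw [Matrix.submatrix_apply, Matrix.kroneckerMap_apply, abs_mul, Nat.cast_mul,
      Real.sqrt_mul (Nat.cast_nonneg _), mul_div_mul_comm, mul_div_mul_comm]
    exact ⟨mul_le_mul h1.1 h2.1 (by positivity) (abs_nonneg _),
      mul_le_mul h1.2 h2.2 (abs_nonneg _) ((abs_nonneg _).trans h1.2)⟩

theorem hasFlatOrthogonal_two_pow (s : ℕ) : HasFlatOrthogonal (2 ^ s) 1 1 := by
  induction s with
  | zero => exact hasFlatPerfectSequence_one.hasFlatOrthogonal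
  | succ s ih => simpa [pow_succ] using ih.mul zero_le_one hasFlatOrthogonal_two

theorem hasFlatOrthogonal_prod {a b : ℝ} (ha : 0 ≤ a) (P : Multiset ℕ)
    (hP : ∀ p ∈ P, HasFlatOrthogonal p a b) :
    HasFlatOrthogonal P.prod (a ^ P.card) (b ^ P.card) := by
  induction P using Multiset.induction with
  | empty => simpa using hasFlatPerfectSequence_one.hasFlatOrthogonal
  | cons p P ih =>
    rw [Multiset.prod_cons, Multiset.card_cons, pow_succ', pow_succ']
    exact (hP p (Multiset.mem_cons_self _ _)).mul (by positivity)
      (ih fun q hq => hP q (Multiset.mem_cons_of_mem hq))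

theorem hasFlatPerfectSequence_prod {a b : ℝ} (ha : 0 ≤ a) (P : Multiset ℕ) (hnd : P.Nodup)
    (hprime : ∀ p ∈ P, p.Prime) (hP : ∀ p ∈ P, HasFlatPerfectSequence p a b) :
    HasFlatPerfectSequence P.prod (a ^ P.card) (b ^ P.card) := by
  induction P using Multiset.induction with
  | empty => simpa using hasFlatPerfectSequence_one
  | cons p P ih =>
    rw [Multiset.prod_cons, Multiset.card_cons, pow_succ', pow_succ']
    rw [Multiset.nodup_cons] at hnd
    refine HasFlatPerfectSequence.mul ?_ (by positivity) (hP p (Multiset.mem_cons_self _ _))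
      (ih hnd.2 (fun q hq => hprime q (Multiset.mem_cons_of_mem hq))
        fun q hq => hP q (Multiset.mem_cons_of_mem hq))
    refine Nat.coprime_multiset_prod_right_iff.2 fun q hq => ?_
    rw [Nat.coprime_primes (hprime p (Multiset.mem_cons_self _ _))
      (hprime q (Multiset.mem_cons_of_mem hq))]
    rintro rfl
    exact hnd.1 hq

/-! ### Counting odd prime factors, and assembly -/

/-- Membership in `largeOddPrimes m` bounds the primes of some factorization; this transfers the
bound to any other. -/
theorem IsTwoPowFactorization.mem_of_mem {n s s' : ℕ} {P P' : Multiset ℕ}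
    (h : IsTwoPowFactorization n s P) (h' : IsTwoPowFactorization n s' P') {p : ℕ} (hp : p ∈ P) :
    p ∈ P' := by
  obtain ⟨hprime, hodd⟩ := h.1 p hp
  have hdvd : p ∣ 2 ^ s' * P'.prod := by
    rw [← h'.2, h.2]
    exact (Multiset.dvd_prod hp).mul_left _
  rcases (Nat.Prime.dvd_mul hprime).1 hdvd with h2 | h2
  · have := (Nat.prime_dvd_prime_iff_eq hprime Nat.prime_two).1 (hprime.dvd_of_dvd_pow h2)
    subst this
    exact absurd hodd (by decide)
  · obtain ⟨q, hq, hpq⟩ := hprime.prime.exists_mem_multiset_dvd h2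
    rwa [(Nat.prime_dvd_prime_iff_eq hprime (h'.1 q hq).1).1 hpq]

/-- With `r = P.card`, `n^(r/m) ≤ P.prod ≤ n`, and `n > 1` lets the exponents be compared. -/
theorem IsTwoPowFactorization.card_le {m : ℝ} (hm : 0 < m) {n s : ℕ} (hn : 1 < n)
    {P : Multiset ℕ} (h : IsTwoPowFactorization n s P)
    (hP : ∀ p ∈ P, (n : ℝ) ^ (1 / m) ≤ (p : ℝ)) : P.card ≤ ⌊m⌋₊ := by
  have hn' : (1 : ℝ) < n := by exact_mod_cast hn
  have h1 : ((n : ℝ) ^ (1 / m)) ^ P.card ≤ (P.prod : ℝ) := by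
    clear h
    induction P using Multiset.induction with
    | empty => simp
    | cons p P ih =>
      rw [Multiset.prod_cons, Multiset.card_cons, pow_succ', Nat.cast_mul]
      exact mul_le_mul (hP p (Multiset.mem_cons_self _ _))
        (ih fun q hq => hP q (Multiset.mem_cons_of_mem hq)) (by positivity) (by positivity)
  have h2 : (P.prod : ℝ) ≤ n := by
    rw [h.2]
    exact_mod_cast Nat.le_mul_of_pos_left _ (by positivity)
  have h3 : (n : ℝ) ^ (1 / m * P.card) ≤ (n : ℝ) ^ (1 : ℝ) := by
    rw [Real.rpow_mul (by positivity), Real.rpow_natCast, Real.rpow_one]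
    exact h1.trans h2
  rw [Real.rpow_le_rpow_left_iff hn', one_div, inv_mul_le_iff₀ hm, mul_one] at h3
  exact Nat.le_floor h3

/-- Large members of `largeOddPrimes m` have boundedly many odd prime factors, all of them large,
so that the flat perfect sequences of prime length multiply up with small total error. -/
theorem eventually_flat_of_factorization {m : ℝ} (hm : 0 < m) {ε : ℝ} (hε : 0 < ε) :
    ∀ᶠ n : ℕ in atTop, n ∈ largeOddPrimes m → ∃ a b : ℝ, 0 ≤ a ∧
      ∀ s P, IsTwoPowFactorization n s P →
        (∀ p ∈ P, HasFlatPerfectSequence p a b) ∧ 1 - ε ≤ a ^ P.card ∧ b ^ P.card ≤ 1 + ε := by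
  obtain ⟨η, hη0, hη1, hlow, hupp⟩ : ∃ η : ℝ, 0 < η ∧ η < 1 ∧ 1 - ε ≤ (1 - η) ^ ⌊m⌋₊ ∧
      (1 + η) ^ ⌊m⌋₊ ≤ 1 + ε := by
    have h1 : Tendsto (fun η : ℝ => (1 - η) ^ ⌊m⌋₊) (𝓝 0) (𝓝 1) := by
      have : Continuous fun η : ℝ => (1 - η) ^ ⌊m⌋₊ := by fun_prop
      simpa using this.tendsto 0
    have h2 : Tendsto (fun η : ℝ => (1 + η) ^ ⌊m⌋₊) (𝓝 0) (𝓝 1) := by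
      have : Continuous fun η : ℝ => (1 + η) ^ ⌊m⌋₊ := by fun_prop
      simpa using this.tendsto 0
    have h3 := ((h1.eventually (lt_mem_nhds (by linarith : 1 - ε < 1))).and
      ((h2.eventually (gt_mem_nhds (by linarith : 1 < 1 + ε))).and
        (gt_mem_nhds (zero_lt_one' ℝ))))
    obtain ⟨η, ⟨hη, hη', hη1⟩, hη0⟩ :=
      ((h3.filter_mono nhdsWithin_le_nhds).and (self_mem_nhdsWithin (s := Set.Ioi (0 : ℝ)))).exists
    exact ⟨η, hη0, hη1, hη.le, hη'.le⟩
  obtain ⟨N, hN⟩ := eventually_atTop.1 (eventually_hasFlatPerfectSequence_of_prime hη0)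
  have hroot : ∀ᶠ n : ℕ in atTop, (N : ℝ) ≤ (n : ℝ) ^ (1 / m) :=
    ((tendsto_rpow_atTop (one_div_pos.2 hm)).comp tendsto_natCast_atTop_atTop).eventually
      (eventually_ge_atTop _)
  filter_upwards [hroot, eventually_gt_atTop 1] with n hn hn1 hmem
  obtain ⟨s', P', hf', hP'⟩ := hmem
  refine ⟨1 - η, 1 + η, by linarith, fun s P hf => ?_⟩
  have hP : ∀ p ∈ P, (n : ℝ) ^ (1 / m) ≤ (p : ℝ) := fun p hp => hP' p (hf.mem_of_mem hf' hp)
  have hcard := hf.card_le hm hn1 hP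
  refine ⟨fun p hp => hN p (by exact_mod_cast hn.trans (hP p hp)) (hf.1 p hp).1 (hf.1 p hp).2,
    hlow.trans (pow_le_pow_of_le_one (by linarith) (by linarith) hcard),
    (pow_le_pow_right₀ (by linarith) hcard).trans hupp⟩

/-- The error at `n` is the infimum of the nonnegative admissible ones plus `1 / (n + 1)`, as the
infimum need not be attained. -/
theorem exists_tendsto_zero_of_eventually {S : Set ℕ} {Q : ℕ → ℝ → Prop}
    (hmono : ∀ n e e', e ≤ e' → Q n e → Q n e') (hex : ∀ n ∈ S, ∃ e, Q n e)
    (hev : ∀ ε > 0, ∀ᶠ n in atTop, n ∈ S → Q n ε) :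
    ∃ ε : ℕ → ℝ, Tendsto ε atTop (𝓝 0) ∧ ∀ n ∈ S, Q n (ε n) := by
  classical
  let T : ℕ → Set ℝ := fun n => {e | 0 ≤ e ∧ Q n e}
  have hT0 : ∀ n, 0 ≤ sInf (T n) := fun n => Real.sInf_nonneg fun e he => he.1
  have hTbdd : ∀ n, BddBelow (T n) := fun n => ⟨0, fun e he => he.1⟩
  refine ⟨fun n => if n ∈ S then sInf (T n) + 1 / ((n : ℝ) + 1) else 0, ?_, ?_⟩
  · rw [tendsto_order]
    constructor
    · intro x hx
      refine Eventually.of_forall fun n => hx.trans_le ?_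
      have := hT0 n
      split_ifs <;> positivity
    · intro x hx
      have h := (tendsto_one_div_add_atTop_nhds_zero_nat (𝕜 := ℝ)).eventually
        (gt_mem_nhds (half_pos hx))
      filter_upwards [h, hev (x / 2) (half_pos hx)] with n hn hQ
      split_ifs with hS
      · have := csInf_le (hTbdd n) (⟨(half_pos hx).le, hQ hS⟩ : x / 2 ∈ T n)
        linarith
      · exact hx
  · intro n hn
    obtain ⟨e, he⟩ := hex n hn
    have hne : (T n).Nonempty :=
      ⟨max e 0, le_max_right _ _, hmono _ _ _ (le_max_left _ _) he⟩
    obtain ⟨e', he', hlt⟩ := Real.lt_sInf_add_pos hne (Nat.one_div_pos_of_nat (α := ℝ) (n := n))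
    simp only [hn, if_true]
    exact hmono _ _ _ hlt.le he'.2

theorem isFlatWithError_mono {n : ℕ} {M : Matrix (Fin n) (Fin n) ℝ} {e e' : ℝ} (h : e ≤ e')
    (hM : IsFlatWithError e M) : IsFlatWithError e' M := fun i j =>
  ⟨le_trans (by gcongr) (hM i j).1, (hM i j).2.trans (by gcongr)⟩

/-- A crude witness for the small `n`: with this error the lower bound is nonpositive and the upper
one at least 1. -/
theorem isFlatWithError_one (n : ℕ) :
    IsFlatWithError (√(n : ℝ) + 1) (1 : Matrix (Fin n) (Fin n) ℝ) := by
  intro i j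
  have hn : (0 : ℝ) < n := Nat.cast_pos.2 (Fin.pos i)
  have hs : 0 < √(n : ℝ) := Real.sqrt_pos.2 hn
  have h1 : |(1 : Matrix (Fin n) (Fin n) ℝ) i j| ≤ 1 := by
    rw [Matrix.one_apply]; split_ifs <;> simp
  constructor
  · exact (div_nonpos_of_nonpos_of_nonneg (by linarith) hs.le).trans (abs_nonneg _)
  · refine h1.trans ?_
    rw [le_div_iff₀ hs]
    linarith

theorem isCirculant_one (n : ℕ) : IsCirculant (1 : Matrix (Fin n) (Fin n) ℝ) := by
  cases n with
  | zero => exact ⟨fun _ => 0, Subsingleton.elim _ _⟩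
  | succ n => exact ⟨_, (Matrix.circulant_single_one ℝ (Fin (n + 1))).symm⟩

theorem corollary3p3 (m : ℝ) (hm : 0 < m) :
    (∃ ε : ℕ → ℝ, Tendsto ε atTop (𝓝 0) ∧
      ∀ n ∈ largeOddPrimes m,
        ∃ M ∈ Matrix.orthogonalGroup (Fin n) ℝ, IsFlatWithError (ε n) M) ∧
    (∃ ε : ℕ → ℝ, Tendsto ε atTop (𝓝 0) ∧
      ∀ n ∈ largeOddPrimes m, ∀ (s : ℕ) (P : Multiset ℕ),
        IsTwoPowFactorization n s P → P.Nodup → (s = 0 ∨ s = 2) →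
          ∃ M ∈ Matrix.orthogonalGroup (Fin n) ℝ, IsCirculant M ∧ IsFlatWithError (ε n) M) := by
  constructor
  · refine exists_tendsto_zero_of_eventually
      (Q := fun n e => ∃ M ∈ Matrix.orthogonalGroup (Fin n) ℝ, IsFlatWithError e M) ?_ ?_ ?_
    · rintro n e e' hle ⟨M, hM, hf⟩
      exact ⟨M, hM, isFlatWithError_mono hle hf⟩
    · exact fun n _ => ⟨_, 1, one_mem _, isFlatWithError_one n⟩
    · intro ε hε
      filter_upwards [eventually_flat_of_factorization hm hε] with n hn hmem
      obtain ⟨a, b, ha, hab⟩ := hn hmem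
      obtain ⟨s, P, hf, -⟩ := hmem
      obtain ⟨hP, hlow, hupp⟩ := hab s P hf
      have h := (hasFlatOrthogonal_two_pow s).mul (by positivity)
        (hasFlatOrthogonal_prod ha P fun p hp => (hP p hp).hasFlatOrthogonal)
      rw [← hf.2, one_mul, one_mul] at h
      obtain ⟨M, hM, hflat⟩ := h
      exact ⟨M, hM, fun i j => ⟨le_trans (by gcongr) (hflat i j).1,
        (hflat i j).2.trans (by gcongr)⟩⟩
  · refine exists_tendsto_zero_of_eventually
      (Q := fun n e => ∀ (s : ℕ) (P : Multiset ℕ),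
        IsTwoPowFactorization n s P → P.Nodup → (s = 0 ∨ s = 2) →
          ∃ M ∈ Matrix.orthogonalGroup (Fin n) ℝ, IsCirculant M ∧ IsFlatWithError e M) ?_ ?_ ?_
    · intro n e e' hle h s P hf hnd hs
      obtain ⟨M, hM, hc, hflat⟩ := h s P hf hnd hs
      exact ⟨M, hM, hc, isFlatWithError_mono hle hflat⟩
    · exact fun n _ => ⟨_, fun _ _ _ _ _ =>
        ⟨1, one_mem _, isCirculant_one n, isFlatWithError_one n⟩⟩
    · intro ε hε
      filter_upwards [eventually_flat_of_factorization hm hε] with n hn hmem s P hf hnd hs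
      obtain ⟨a, b, ha, hab⟩ := hn hmem
      obtain ⟨hP, hlow, hupp⟩ := hab s P hf
      have h2 : HasFlatPerfectSequence (2 ^ s) 1 1 := by
        rcases hs with rfl | rfl
        · exact hasFlatPerfectSequence_one
        · exact hasFlatPerfectSequence_four
      have hcop : (2 ^ s).Coprime P.prod :=
        Nat.Coprime.pow_left _ (Nat.coprime_multiset_prod_right_iff.2 fun p hp =>
          (Nat.coprime_two_left).2 (hf.1 p hp).2)
      have h := h2.mul hcop (by positivity)
        (hasFlatPerfectSequence_prod ha P hnd (fun p hp => (hf.1 p hp).1) hP)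
      rw [← hf.2, one_mul, one_mul] at h
      obtain ⟨M, hM, hc, hflat⟩ := h.exists_circulant
      exact ⟨M, hM, hc, fun i j => ⟨le_trans (by gcongr) (hflat i j).1,
        (hflat i j).2.trans (by gcongr)⟩⟩
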